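/- Let $G$ be a semisimple algebraic group over an algebraically closed field of characteristic $0$, with maximal torus $T$, Borel subgroup $B\supset T$, root system $R$, simple roots $S$ and Weyl group $W$ with length function $\ell$ and Bruhat order $\le$. Let $P\supset B$ be a parabolic subgroup, $S_P\subseteq S$ its set of simple roots, $W_P\subseteq W$ the subgroup generated by the simple reflections $s_\alpha$, $\alpha\in S_P$, and $W^P$ the set of those $v\in W$ that have minimal length in their coset $vW_P$, ordered by the restriction of the Bruhat order. Put $[e,w]_{W^P}=\{v\in W^P : e\le v\le w\}$. A family $\mathcal F$ of subsets of a finite totally ordered set $(E,\preccurlyeq)$ is called a *supersolvable antimatroid* if $\emptyset\in\mathcal F$ and, for all $A,B\in\mathcal F$ with $B\not\subseteq A$, one has $A\cup\{x\}\in\mathcal F$ for $x=\min_{\preccurlyeq}(B\setminus A)$; the members of $\mathcal F$ are its *feasible sets*. A finite lattice is *supersolvable* if it has a maximal chain $\mathfrak m$ such that for every chain $\mathfrak c$ the sublattice generated by $\mathfrak m\cup\mathfrak c$ is distributive. It is *join-distributive* if for each element $x$ the interval from $x$ to the join of $x$ and all the elements covering $x$ is a Boolean lattice. **Theorem.** Let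 $w\in W^P$ be of Coxeter type, that is, a product of pairwise distinct simple reflections. Let $w=s_{i_1}s_{i_2}\cdots s_{i_r}$, $r=\ell(w)$, be any reduced word of $w$ (one exists). For $A\subseteq\{1,\dots,r\}$ let $v_A=\prod_{j\in A}s_{i_j}$, the product taken in increasing order of the indices, and let $\mathcal F=\{A\subseteq\{1,\dots,r\} : v_A\in W^P\}$. Then $\mathcal F$ is a supersolvable antimatroid on $\{1,\dots,r\}$ with the reverse order $r\prec r-1\prec\cdots\prec 1$, and $A\mapsto v_A$ is an isomorphism of ordered sets from $(\mathcal F,\subseteq)$ onto $[e,w]_{W^P}$. Consequently $[e,w]_{W^P}$ is a supersolvable join-distributive lattice; in particular it is a supersolvable lattice. -/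

import Mathlib

/-! ### Supersolvable and join-distributive lattices, supersolvable antimatroids -/

/-- A finite lattice is supersolvable if it has a maximal chain `m` (an `M`-chain) such that,
for every chain `c`, the sublattice generated by `m ∪ c` is distributive. -/
def IsSupersolvableLattice (L : Type*) [Lattice L] : Prop :=
  Finite L ∧ Nonempty L ∧
    ∃ m : Set L, IsMaxChain (· ≤ ·) m ∧
      ∀ c : Set L, IsChain (· ≤ ·) c →
        ∀ x ∈ latticeClosure (m ∪ c), ∀ y ∈ latticeClosure (m ∪ c),
          ∀ z ∈ latticeClosure (m ∪ c), x ⊓ (y ⊔ z) = (x ⊓ y) ⊔ (x ⊓ z)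

/-- A finite lattice is join-distributive if, for every `x`, the interval `[x, j]` is a Boolean
lattice, where `j` is the join of all the elements that cover `x`
(and `j = x` if there are none). -/
def IsJoinDistributiveLattice (L : Type*) [Lattice L] : Prop :=
  Finite L ∧ Nonempty L ∧
    ∀ x j : L, IsLUB (insert x {y | x ⋖ y}) j →
      ∃ n : ℕ, Nonempty (Set.Icc x j ≃o Set (Fin n))

/-- A family `F` of subsets of a finite totally ordered set `E` is (the family of feasible sets
of) a supersolvable antimatroid if `∅ ∈ F` and, for all `A B ∈ F` with `B ⊄ A`, adding to `A` the
least element of `B \ A` gives a member of `F`. -/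
def IsSupersolvableAntimatroid {E : Type*} [LinearOrder E] [Finite E]
    (F : Set (Finset E)) : Prop :=
  ∅ ∈ F ∧ ∀ A ∈ F, ∀ B ∈ F, ∀ x : E, IsLeast {y | y ∈ B ∧ y ∉ A} x → insert x A ∈ F

/-! ### Weyl groups: length, Bruhat order, minimal coset representatives -/

namespace RootPairing.Base

variable {ι M N : Type*} [AddCommGroup M] [Module ℝ M] [AddCommGroup N] [Module ℝ N]
  {P : RootPairing ι ℝ M N} (b : P.Base)

/-- The product `s_{i₁} ⋯ s_{iᵣ}` in the Weyl group of a word in the simple reflections. -/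
noncomputable def wordProd (l : List b.support) : P.weylGroup :=
  (l.map fun i => RootPairing.weylGroup.ofIdx P i).prod

/-- The length of `w`: the least number of letters of a word in the simple reflections
with product `w`. -/
noncomputable def length (w : P.weylGroup) : ℕ :=
  sInf {n | ∃ l : List b.support, b.wordProd l = w ∧ l.length = n}

/-- `l` is a reduced word of `w`. -/
def IsReducedWord (l : List b.support) (w : P.weylGroup) : Prop :=
  b.wordProd l = w ∧ l.length = b.length w

/-- `w` is of Coxeter type: a product of pairwise distinct simple reflections. -/
def IsCoxeterType (w : P.weylGroup) : Prop :=
  ∃ l : List b.support, l.Nodup ∧ b.wordProd l = w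

/-- The subgroup `W_P` generated by the simple reflections in a set `J` of simple roots. -/
noncomputable def parabolicSubgroup (J : Set b.support) : Subgroup P.weylGroup :=
  Subgroup.closure ((fun i : b.support => RootPairing.weylGroup.ofIdx P i) '' J)

/-- The set `W^P` of those `w` that have minimal length in their coset `w W_P`. -/
def minCosetReps (J : Set b.support) : Set P.weylGroup :=
  {w | ∀ u ∈ b.parabolicSubgroup J, b.length w ≤ b.length (w * u)}

/-- The Bruhat order on the Weyl group: the reflexive transitive closure of the relation
`u → u * t` with `t` the reflection in some root (not necessarily simple) and
`ℓ(u) < ℓ(u * t)`. -/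
def BruhatLE : P.weylGroup → P.weylGroup → Prop :=
  Relation.ReflTransGen fun u v =>
    (∃ i : ι, v = u * RootPairing.weylGroup.ofIdx P i) ∧ b.length u < b.length v

theorem BruhatLE.eq_or_length_lt {u v : P.weylGroup} (h : b.BruhatLE u v) :
    u = v ∨ b.length u < b.length v := by
  induction h with
  | refl => exact Or.inl rfl
  | tail _ hbc ih =>
    rcases ih with rfl | ih
    · exact Or.inr hbc.2
    · exact Or.inr (ih.trans hbc.2)

theorem BruhatLE.antisymm {u v : P.weylGroup} (h : b.BruhatLE u v) (h' : b.BruhatLE v u) :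
    u = v := by
  rcases BruhatLE.eq_or_length_lt b h with h | h
  · exact h
  · rcases BruhatLE.eq_or_length_lt b h' with h' | h'
    · exact h'.symm
    · exact absurd h' h.asymm

/-- The interval `[e, w]` in `W^P`. -/
def ProjInterval (J : Set b.support) (w : P.weylGroup) : Type _ :=
  {v : P.weylGroup // v ∈ b.minCosetReps J ∧ b.BruhatLE 1 v ∧ b.BruhatLE v w}

/-- The interval `[e, w]` in `W^P` is ordered by the (restricted) Bruhat order. -/
instance (J : Set b.support) (w : P.weylGroup) : PartialOrder (b.ProjInterval J w) where
  le u v := b.BruhatLE u.1 v.1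
  le_refl _ := Relation.ReflTransGen.refl
  le_trans _ _ _ h h' := Relation.ReflTransGen.trans h h'
  le_antisymm _ _ h h' := Subtype.ext (BruhatLE.antisymm b h h')

/-- The subword product `v_A`: the product of the letters of `l` at the positions in `A`, in
increasing order of the positions. The positions are regarded as elements of `(Fin r)ᵒᵈ`,
that is, the set of positions carries the reverse of its usual order. -/
noncomputable def subwordProd (l : List b.support) (A : Finset (Fin l.length)ᵒᵈ) : P.weylGroup :=
  b.wordProd
    (((List.finRange l.length).filter fun j => OrderDual.toDual j ∈ A).map fun j => l.get j)

/-- The family of those sets `A` of positions of the word `l` for which `v_A ∈ W^P`. -/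
def feasibleSets (J : Set b.support) (l : List b.support) :
    Set (Finset (Fin l.length)ᵒᵈ) :=
  {A | b.subwordProd l A ∈ b.minCosetReps J}

end RootPairing.Base

/-! ### The Weyl group acting on weights and roots. -/

namespace RootPairing.weylGroup

variable {ι M N : Type*} [AddCommGroup M] [Module ℝ M] [AddCommGroup N] [Module ℝ N]
  {P : RootPairing ι ℝ M N}

/-! Everything reduces to a combinatorial description of feasibility. If a word has distinct
letters, its product lies in `W^P` iff each letter from `J` is followed by some letter not
orthogonal to it (`wordProd_mem_minCosetReps_iff`). In the reversed order on positions this says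
that each guarded element of `A` has a smaller neighbour in `A`, which is membership in a
`guardedFamily` (`feasibleSets_eq`).

Fundamental weights show that a product of distinct simple reflections determines its letters, so
reduced words of `w` have no repetitions. With strong exchange, Bruhat order below `w` becomes
inclusion of position sets (`subwordProd_bruhatLE_iff`).

The lattice properties hold for every guarded family containing the whole set. It is closed under
union, and covers add one element, which gives join-distributivity. Initial segments form the
M-chain: together with a chain they generate lower sets of one preorder, where meets are plain
intersections (`mem_of_forall_chain`). -/

theorem ext_smul {g h : P.weylGroup} (H : ∀ m : M, g • m = h • m) : g = h := by
  apply Subtype.ext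
  apply RootPairing.Equiv.weightHom_injective P
  ext m
  exact H m

theorem ofIdx_smul_eq (i : ι) (m : M) :
    ofIdx P i • m = m - P.toLinearMap m (P.coroot i) • P.root i :=
  P.reflection_apply i m

theorem root_smul (g : P.weylGroup) (i : ι) : P.root (g • i) = g • P.root i :=
  RootPairing.Equiv.root_indexEquiv_eq_smul P i g.1

theorem smul_sub_smul_root (g : P.weylGroup) (m : M) (c : ℝ) (i : ι) :
    g • (m - c • P.root i) = g • m - c • (g • P.root i) := by
  rw [smul_sub]
  congr 1
  exact smul_comm g.1 c (P.root i)

@[simp]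
theorem ofIdx_mul_self (i : ι) : ofIdx P i * ofIdx P i = 1 := by
  apply ext_smul
  intro m
  rw [mul_smul, one_smul]
  exact P.reflection_same i m

theorem ofIdx_smul_self_root (i : ι) : ofIdx P i • P.root i = -P.root i :=
  P.reflection_apply_self i

theorem ofIdx_ofIdx_smul (i j : ι) :
    ofIdx P (ofIdx P j • i) = ofIdx P j * ofIdx P i * ofIdx P j := by
  apply ext_smul
  intro m
  rw [mul_smul, mul_smul]
  exact DFunLike.congr_fun (P.reflection_reflectionPerm (i := i) (j := j)) m

theorem ofIdx_smul_self_idx (i : ι) : ofIdx P (ofIdx P i • i) = ofIdx P i := by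
  simp [ofIdx_ofIdx_smul]

end RootPairing.weylGroup

/-! ### Words, strong exchange and minimal coset representatives. -/

namespace RootPairing.Base

open RootPairing.weylGroup

variable {ι M N : Type*} [AddCommGroup M] [Module ℝ M] [AddCommGroup N] [Module ℝ N]
  {P : RootPairing ι ℝ M N} (b : P.Base)

@[simp] theorem wordProd_nil : b.wordProd [] = 1 := rfl

@[simp] theorem wordProd_cons (i : b.support) (l : List b.support) :
    b.wordProd (i :: l) = ofIdx P i * b.wordProd l := by
  simp [wordProd]

@[simp] theorem wordProd_append (l l' : List b.support) :
    b.wordProd (l ++ l') = b.wordProd l * b.wordProd l' := by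
  simp [wordProd]

theorem ofIdx_wordProd_smul (l : List b.support) (i : ι) :
    ofIdx P (b.wordProd l • i) * b.wordProd l = b.wordProd l * ofIdx P i := by
  induction l with
  | nil => simp
  | cons j l ih =>
    rw [wordProd_cons, mul_smul, ofIdx_ofIdx_smul]
    calc _ = ofIdx P j * ofIdx P (b.wordProd l • i) * (ofIdx P j * ofIdx P j) * b.wordProd l := by
          simp only [mul_assoc]
      _ = _ := by rw [ofIdx_mul_self, mul_one, mul_assoc, ih, mul_assoc]

theorem isPos_smul_self_iff (g : P.weylGroup) (i : ι) :
    b.IsPos (g • ofIdx P i • i) ↔ ¬ b.IsPos (g • i) := by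
  let := P.indexNeg
  have : g • ofIdx P i • i = -(g • i) := by
    apply P.root.injective
    change _ = P.root (P.reflectionPerm (g • i) (g • i))
    rw [P.root_reflectionPerm, P.reflection_apply_self, root_smul, root_smul, root_smul, ofIdx_smul_self_root,
      smul_neg]
  rw [this, IsPos.neg_iff_not]

theorem length_le (l : List b.support) : b.length (b.wordProd l) ≤ l.length :=
  Nat.sInf_le ⟨l, rfl, rfl⟩

/-- Moving the reflection in `β` leftwards past `l₂` turns it into the simple reflection of `i`,
which cancels the letter `i`. -/
theorem wordProd_delete {l₁ l₂ : List b.support} {i : b.support} {β : ι}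
    (h : b.wordProd l₂ • β = (i : ι)) :
    b.wordProd (l₁ ++ i :: l₂) * ofIdx P β = b.wordProd (l₁ ++ l₂) := by
  have := b.ofIdx_wordProd_smul l₂ β
  rw [h] at this
  rw [wordProd_append, wordProd_cons, wordProd_append, this]
  simp [mul_assoc]

theorem ofIdx_mem_parabolicSubgroup {J : Set b.support} {i : b.support} (hi : i ∈ J) :
    ofIdx P i ∈ b.parabolicSubgroup J :=
  Subgroup.subset_closure ⟨i, hi, rfl⟩

theorem wordProd_mem_parabolicSubgroup {J : Set b.support} {l : List b.support}
    (hl : ∀ i ∈ l, i ∈ J) : b.wordProd l ∈ b.parabolicSubgroup J := by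
  induction l with
  | nil => exact one_mem _
  | cons i l ih =>
    rw [wordProd_cons]
    exact mul_mem (b.ofIdx_mem_parabolicSubgroup (hl i (by simp)))
      (ih fun j hj => hl j (by simp [hj]))

theorem exists_wordProd_of_mem_parabolicSubgroup {J : Set b.support} {u : P.weylGroup}
    (hu : u ∈ b.parabolicSubgroup J) : ∃ l, (∀ i ∈ l, i ∈ J) ∧ b.wordProd l = u := by
  induction hu using Subgroup.closure_induction'' with
  | mem x hx =>
    obtain ⟨i, hi, rfl⟩ := hx
    exact ⟨[i], by simpa using hi, by simp⟩
  | inv_mem x hx =>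
    obtain ⟨i, hi, rfl⟩ := hx
    exact ⟨[i], by simpa using hi, by simp [eq_inv_iff_mul_eq_one]⟩
  | one => exact ⟨[], by simp, rfl⟩
  | mul x y _ _ ihx ihy =>
    obtain ⟨l, hl, rfl⟩ := ihx
    obtain ⟨l', hl', rfl⟩ := ihy
    exact ⟨l ++ l', fun i hi => (List.mem_append.1 hi).elim (hl i) (hl' i),
      by simp⟩

theorem exists_mul_mem_minCosetReps (J : Set b.support) (g : P.weylGroup) :
    ∃ u ∈ b.parabolicSubgroup J, g * u ∈ b.minCosetReps J := by
  obtain ⟨u, hu, hmin⟩ := WellFounded.has_min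
    (InvImage.wf (fun u => b.length (g * u)) wellFounded_lt)
    (b.parabolicSubgroup J : Set P.weylGroup) ⟨1, one_mem _⟩
  refine ⟨u, hu, fun v hv => ?_⟩
  rw [mul_assoc]
  exact not_lt.1 (hmin (u * v) (mul_mem hu hv))

variable [Finite ι] [P.IsCrystallographic] [P.IsReduced]

theorem exists_wordProd_ofIdx (i : ι) : ∃ l, b.wordProd l = ofIdx P i := by
  induction i using b.induction_reflect with
  | h₀ i h =>
    obtain ⟨l, h⟩ := h
    exact ⟨l, h.trans (ofIdx_smul_self_idx i).symm⟩
  | h₁ i hi => exact ⟨[⟨i, hi⟩], by simp⟩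
  | h₂ i j h hj =>
    obtain ⟨l, h⟩ := h
    refine ⟨⟨j, hj⟩ :: (l ++ [⟨j, hj⟩]), ?_⟩
    simp only [wordProd_cons, wordProd_append, h, wordProd_nil, mul_one]
    rw [← mul_assoc]
    exact (ofIdx_ofIdx_smul i j).symm

theorem exists_wordProd (g : P.weylGroup) : ∃ l, b.wordProd l = g := by
  obtain ⟨g, hg⟩ := g
  induction hg using weylGroup.induction with
  | mem i => exact b.exists_wordProd_ofIdx i
  | one => exact ⟨[], rfl⟩
  | mul x y hx hy ihx ihy =>
    obtain ⟨l, hl⟩ := ihx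
    obtain ⟨l', hl'⟩ := ihy
    exact ⟨l ++ l', by rw [wordProd_append, hl, hl']; rfl⟩

theorem exists_isReducedWord (g : P.weylGroup) : ∃ l, b.IsReducedWord l g := by
  obtain ⟨l, hl⟩ := b.exists_wordProd g
  exact Nat.sInf_mem (s := {n | ∃ l : List b.support, b.wordProd l = g ∧ l.length = n})
    ⟨_, l, hl, rfl⟩

/-- The letter at which a word turns a positive root into a negative one. -/
theorem exists_split_of_not_isPos {β : ι} (hβ : b.IsPos β) (l : List b.support)
    (h : ¬ b.IsPos (b.wordProd l • β)) :
    ∃ (l₁ : List b.support) (i : b.support) (l₂ : List b.support),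
      l = l₁ ++ i :: l₂ ∧ b.wordProd l₂ • β = (i : ι) := by
  induction l with
  | nil => exact absurd hβ (by simpa using h)
  | cons i l ih =>
    by_cases h' : b.IsPos (b.wordProd l • β)
    · refine ⟨[], i, l, rfl, ?_⟩
      by_contra hne
      apply h
      rw [wordProd_cons, mul_smul]
      -- A simple reflection keeps every positive root positive except its own simple root.
      exact h'.reflectionPerm i.2 hne
    · obtain ⟨l₁, j, l₂, rfl, h2⟩ := ih h'
      exact ⟨i :: l₁, j, l₂, rfl, h2⟩

theorem length_mul_ofIdx_lt_of_not_isPos {β : ι} (hβ : b.IsPos β) {g : P.weylGroup}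
    (h : ¬ b.IsPos (g • β)) : b.length (g * ofIdx P β) < b.length g := by
  obtain ⟨l, rfl, hl⟩ := b.exists_isReducedWord g
  obtain ⟨l₁, i, l₂, rfl, h2⟩ := b.exists_split_of_not_isPos hβ l h
  rw [← hl, b.wordProd_delete h2]
  exact (b.length_le _).trans_lt (by simp)

theorem length_mul_ofIdx_lt_iff {β : ι} (hβ : b.IsPos β) (g : P.weylGroup) :
    b.length (g * ofIdx P β) < b.length g ↔ ¬ b.IsPos (g • β) := by
  refine ⟨fun h hpos => ?_, b.length_mul_ofIdx_lt_of_not_isPos hβ⟩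
  have := b.length_mul_ofIdx_lt_of_not_isPos hβ (g := g * ofIdx P β)
    (by rw [mul_smul, isPos_smul_self_iff]; simpa using hpos)
  rw [mul_assoc, ofIdx_mul_self, mul_one] at this
  exact h.asymm this

/-- The strong exchange property. -/
theorem exists_delete_of_length_lt {l : List b.support} {β : ι}
    (h : b.length (b.wordProd l * ofIdx P β) < b.length (b.wordProd l)) :
    ∃ (l₁ : List b.support) (i : b.support) (l₂ : List b.support),
      l = l₁ ++ i :: l₂ ∧ b.wordProd l * ofIdx P β = b.wordProd (l₁ ++ l₂) := by
  wlog hβ : b.IsPos β generalizing β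
  -- A root and its negative have the same reflection, so `β` may be replaced by its negative.
  · rw [← ofIdx_smul_self_idx β] at h ⊢
    exact this h (by simpa using (b.isPos_smul_self_iff 1 β).2 (by simpa using hβ))
  obtain ⟨l₁, i, l₂, rfl, h2⟩ :=
    b.exists_split_of_not_isPos hβ l ((b.length_mul_ofIdx_lt_iff hβ _).1 h)
  exact ⟨l₁, i, l₂, rfl, b.wordProd_delete h2⟩

theorem isPos_smul_of_mem_minCosetReps {J : Set b.support} {g : P.weylGroup}
    (hg : g ∈ b.minCosetReps J) {β : ι} (hβ : b.IsPos β)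
    (hJ : ofIdx P β ∈ b.parabolicSubgroup J) : b.IsPos (g • β) := by
  by_contra h
  exact (hg _ hJ).not_gt (b.length_mul_ofIdx_lt_of_not_isPos hβ h)

/-- For the converse, let `g * u` be minimal in the coset and `m ++ [j]` a shortest `J`-word of
`u⁻¹`. Then `m` keeps the simple root of `j` positive, and so does `g * u * m` by minimality of `g *
u`. Applying the last letter first flips the sign, so `g` makes that root negative. -/
theorem mem_minCosetReps_iff {J : Set b.support} {g : P.weylGroup} :
    g ∈ b.minCosetReps J ↔ ∀ j ∈ J, b.IsPos (g • (j : ι)) := by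
  refine ⟨fun hg j hj => b.isPos_smul_of_mem_minCosetReps hg (b.isPos_of_mem_support j.2)
    (b.ofIdx_mem_parabolicSubgroup hj), fun h => ?_⟩
  obtain ⟨u, hu, hx⟩ := b.exists_mul_mem_minCosetReps J g
  obtain ⟨l₀, hl₀, hl₀u⟩ := b.exists_wordProd_of_mem_parabolicSubgroup (inv_mem hu)
  obtain ⟨l, ⟨hlJ, hlu⟩, hmin⟩ := WellFounded.has_min
    (InvImage.wf List.length wellFounded_lt)
    {l : List b.support | (∀ i ∈ l, i ∈ J) ∧ b.wordProd l = u⁻¹} ⟨l₀, hl₀, hl₀u⟩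
  rcases l.eq_nil_or_concat' with rfl | ⟨m, j, rfl⟩
  · have : u = 1 := by simpa using hlu.symm
    simpa [this] using hx
  exfalso
  have hmJ : ∀ i ∈ m, i ∈ J := fun i hi => hlJ i (by simp [hi])
  have hjJ : j ∈ J := hlJ j (by simp)
  have hj := b.isPos_of_mem_support j.2
  have hlu' : b.wordProd m * ofIdx P j = u⁻¹ := by simpa using hlu
  have hpos : b.IsPos (b.wordProd m • (j : ι)) := by
    by_contra hneg
    obtain ⟨l₁, i, l₂, rfl, h2⟩ := b.exists_split_of_not_isPos hj m hneg
    rw [b.wordProd_delete h2] at hlu'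
    refine hmin (l₁ ++ l₂) ⟨fun k hk => hmJ k ?_, hlu'⟩ ?_
    · simp only [List.mem_append, List.mem_cons] at hk ⊢
      tauto
    · simp only [InvImage, List.length_append, List.length_cons, List.length_nil]
      omega
  have hmem : ofIdx P (b.wordProd m • (j : ι)) ∈ b.parabolicSubgroup J := by
    rw [eq_mul_inv_of_mul_eq (b.ofIdx_wordProd_smul m j)]
    exact mul_mem (mul_mem (b.wordProd_mem_parabolicSubgroup hmJ)
      (b.ofIdx_mem_parabolicSubgroup hjJ)) (inv_mem (b.wordProd_mem_parabolicSubgroup hmJ))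
  have h1 := b.isPos_smul_of_mem_minCosetReps hx hpos hmem
  have h2 := h j hjJ
  have : g = g * u * b.wordProd m * ofIdx P j := by
    rw [mul_assoc (g * u), hlu']; group
  rw [this, mul_smul, isPos_smul_self_iff, mul_smul] at h2
  exact h2 h1

/-- Each step down in Bruhat order deletes one letter, by strong exchange. -/
theorem exists_sublist_of_bruhatLE {l : List b.support} {v : P.weylGroup}
    (h : b.BruhatLE v (b.wordProd l)) : ∃ l' : List b.support, l'.Sublist l ∧ b.wordProd l' = v := by
  induction h using Relation.ReflTransGen.head_induction_on with
  | refl => exact ⟨l, List.Sublist.refl l, rfl⟩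
  | @head u c huc _ ih =>
    obtain ⟨l', hl', rfl⟩ := ih
    obtain ⟨⟨i, hi⟩, hlt⟩ := huc
    have hu : u = b.wordProd l' * ofIdx P i := by rw [hi, mul_assoc, ofIdx_mul_self, mul_one]
    rw [hu] at hlt
    obtain ⟨l₁, k, l₂, rfl, h⟩ := b.exists_delete_of_length_lt hlt
    exact ⟨l₁ ++ l₂, ((List.Sublist.refl l₁).append (List.sublist_cons_self k l₂)).trans hl',
      by rw [hu, h]⟩

end RootPairing.Base

/-- The family of those `A` in which every element of `A ∩ S` has a smaller neighbour in `A`. -/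
def guardedFamily {E : Type*} [LinearOrder E] (S : Set E) (adj : E → E → Prop) :
    Set (Finset E) :=
  {A | ∀ p ∈ A, p ∈ S → ∃ q ∈ A, q < p ∧ adj p q}

/-! ### Guarded families: antimatroid and lattice properties. -/

namespace guardedFamily

variable {E : Type*} [LinearOrder E] {S : Set E} {adj : E → E → Prop}

theorem isSupersolvableAntimatroid [Finite E] :
    IsSupersolvableAntimatroid (guardedFamily S adj) := by
  refine ⟨fun p hp => absurd hp (Finset.notMem_empty p), fun A hA B hB x hx p hp hpS => ?_⟩
  rcases Finset.mem_insert.1 hp with rfl | hp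
  · obtain ⟨q, hq, hlt, hadj⟩ := hB p hx.1.1 hpS
    refine ⟨q, Finset.mem_insert_of_mem ?_, hlt, hadj⟩
    -- The neighbour of `x` in `B` is smaller than `x`, so it already lies in `A` by the choice of
    -- `x`.
    by_contra hqA
    exact (hx.2 ⟨hq, hqA⟩).not_gt hlt
  · obtain ⟨q, hq, h⟩ := hA p hp hpS
    exact ⟨q, Finset.mem_insert_of_mem hq, h⟩

theorem union_mem {A B : Finset E} (hA : A ∈ guardedFamily S adj)
    (hB : B ∈ guardedFamily S adj) : A ∪ B ∈ guardedFamily S adj := by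
  intro p hp hpS
  rcases Finset.mem_union.1 hp with hp | hp
  · obtain ⟨q, hq, h⟩ := hA p hp hpS
    exact ⟨q, Finset.mem_union_left _ hq, h⟩
  · obtain ⟨q, hq, h⟩ := hB p hp hpS
    exact ⟨q, Finset.mem_union_right _ hq, h⟩

theorem mem_of_forall_exists {A : Finset E}
    (h : ∀ p ∈ A, ∃ B ∈ guardedFamily S adj, p ∈ B ∧ B ⊆ A) : A ∈ guardedFamily S adj := by
  intro p hp hpS
  obtain ⟨B, hB, hpB, hBA⟩ := h p hp
  obtain ⟨q, hq, h⟩ := hB p hpB hpS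
  exact ⟨q, hBA hq, h⟩

section Interior

variable [Fintype E]

open Classical in
/-- The largest member of the family that is contained in `A`. -/
noncomputable def interior (S : Set E) (adj : E → E → Prop) (A : Finset E) : Finset E :=
  Finset.univ.filter fun p => ∃ B ∈ guardedFamily S adj, p ∈ B ∧ B ⊆ A

theorem mem_interior {A : Finset E} {p : E} :
    p ∈ interior S adj A ↔ ∃ B ∈ guardedFamily S adj, p ∈ B ∧ B ⊆ A := by
  simp [interior]

theorem interior_subset (A : Finset E) : interior S adj A ⊆ A := by
  intro p hp
  obtain ⟨B, -, hpB, hBA⟩ := mem_interior.1 hp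
  exact hBA hpB

theorem subset_interior {A B : Finset E} (hB : B ∈ guardedFamily S adj) (h : B ⊆ A) :
    B ⊆ interior S adj A :=
  fun _ hp => mem_interior.2 ⟨B, hB, hp, h⟩

theorem interior_mem (A : Finset E) : interior S adj A ∈ guardedFamily S adj := by
  refine mem_of_forall_exists fun p hp => ?_
  obtain ⟨B, hB, hpB, hBA⟩ := mem_interior.1 hp
  exact ⟨B, hB, hpB, subset_interior hB hBA⟩

theorem exists_lattice {L : Type*} [inst : PartialOrder L] (e : L ≃o guardedFamily S adj) :
    ∃ lat : Lattice L, lat.toPartialOrder = inst := by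
  refine ⟨{ inst with
    sup := fun x y => e.symm ⟨(e x).1 ∪ (e y).1, union_mem (e x).2 (e y).2⟩
    inf := fun x y => e.symm ⟨interior S adj ((e x).1 ∩ (e y).1), interior_mem _⟩
    le_sup_left := fun x y => e.le_symm_apply.2 (Finset.subset_union_left (s₁ := (e x).1))
    le_sup_right := fun x y => e.le_symm_apply.2 (Finset.subset_union_right (s₂ := (e y).1))
    sup_le := fun x y z hx hy => e.symm_apply_le.2
      (Finset.union_subset (e.le_iff_le.2 hx) (e.le_iff_le.2 hy))
    inf_le_left := fun x y => e.symm_apply_le.2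
      ((interior_subset _).trans Finset.inter_subset_left)
    inf_le_right := fun x y => e.symm_apply_le.2
      ((interior_subset _).trans Finset.inter_subset_right)
    le_inf := fun x y z hx hy => e.le_symm_apply.2 (subset_interior (e x).2
      (Finset.subset_inter (e.le_iff_le.2 hx) (e.le_iff_le.2 hy))) }, rfl⟩

end Interior

section Lattice

variable {L : Type*} [Lattice L] (e : L ≃o guardedFamily S adj)

theorem coe_sup (x y : L) : (e (x ⊔ y)).1 = (e x).1 ∪ (e y).1 := by
  apply subset_antisymm
  · have : x ⊔ y ≤ e.symm ⟨(e x).1 ∪ (e y).1, union_mem (e x).2 (e y).2⟩ :=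
      sup_le (e.le_symm_apply.2 (Finset.subset_union_left (s₁ := (e x).1)))
        (e.le_symm_apply.2 (Finset.subset_union_right (s₂ := (e y).1)))
    exact e.le_symm_apply.1 this
  · exact Finset.union_subset (e.le_iff_le.2 le_sup_left) (e.le_iff_le.2 le_sup_right)

theorem coe_inf {x y : L} (h : (e x).1 ∩ (e y).1 ∈ guardedFamily S adj) :
    (e (x ⊓ y)).1 = (e x).1 ∩ (e y).1 := by
  apply subset_antisymm
  · exact Finset.subset_inter (e.le_iff_le.2 inf_le_left) (e.le_iff_le.2 inf_le_right)
  · have : e.symm ⟨_, h⟩ ≤ x ⊓ y :=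
      le_inf (e.symm_apply_le.2 (Finset.inter_subset_left (s₁ := (e x).1)))
        (e.symm_apply_le.2 (Finset.inter_subset_right (s₂ := (e y).1)))
    exact e.symm_apply_le.1 this

/-- The elements of the lattice that correspond to initial segments. -/
def lowerElements : Set L := {a | IsLowerSet ((e a).1 : Set E)}

/-- An element comparable with all principal initial segments is itself an initial segment; these
segments are feasible because the whole set is, guards being smaller. -/
theorem isMaxChain_lowerElements [Fintype E] (huniv : Finset.univ ∈ guardedFamily S adj) :
    IsMaxChain (· ≤ ·) (lowerElements e) := by
  refine ⟨fun x hx y hy _ => ?_, fun c hc hsub => hsub.antisymm fun x hx p q hqp hp => ?_⟩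
  · rcases IsLowerSet.total hx hy with h | h
    · exact Or.inl (e.le_iff_le.1 (Finset.coe_subset.1 h))
    · exact Or.inr (e.le_iff_le.1 (Finset.coe_subset.1 h))
  · classical
    let I : Finset E := Finset.univ.filter (· ≤ q)
    have hI : I ∈ guardedFamily S adj := by
      intro p hp hpS
      obtain ⟨q', -, hlt, hadj⟩ := huniv p (Finset.mem_univ p) hpS
      exact ⟨q', by simpa [I] using hlt.le.trans (by simpa [I] using hp), hlt, hadj⟩
    have hIc : e.symm ⟨I, hI⟩ ∈ c := by
      apply hsub
      intro a a' ha h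
      simp only [OrderIso.apply_symm_apply, Finset.mem_coe, I, Finset.mem_filter,
        Finset.mem_univ, true_and] at h ⊢
      exact ha.trans h
    rcases hc.total hx hIc with h | h
    · have h' : (e x).1 ⊆ I := e.le_symm_apply.1 h
      have hpq : p ≤ q := by simpa [I] using h' hp
      rwa [hqp.antisymm hpq]
    · have h' : I ⊆ (e x).1 := e.symm_apply_le.1 h
      exact h' (by simp [I])

/-- The hypothesis says that `X` is a lower set for the preorder "`q ≤ p`, and each member of `c`
containing `p` contains `q`". The guard of `p` inside the smallest member of `c` containing `p` (or
in the whole set if there is none) lies below `p` in this preorder. -/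
theorem mem_of_forall_chain [Fintype E] (huniv : Finset.univ ∈ guardedFamily S adj) {c : Set L}
    (hc : IsChain (· ≤ ·) c) {X : Finset E}
    (hX : ∀ p ∈ X, ∀ q ≤ p, (∀ a ∈ c, p ∈ (e a).1 → q ∈ (e a).1) → q ∈ X) :
    X ∈ guardedFamily S adj := by
  intro p hp hpS
  have : Finite L := Finite.of_equiv _ e.symm.toEquiv
  suffices ∃ B ∈ guardedFamily S adj, p ∈ B ∧ ∀ a ∈ c, p ∈ (e a).1 → B ⊆ (e a).1 by
    obtain ⟨B, hB, hpB, hmin⟩ := this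
    obtain ⟨q, hq, hlt, hadj⟩ := hB p hpB hpS
    exact ⟨q, hX p hp q hlt.le fun a ha hpa => hmin a ha hpa hq, hlt, hadj⟩
  by_cases hne : ({a | a ∈ c ∧ p ∈ (e a).1} : Set L).Nonempty
  · obtain ⟨a, ha, hmin⟩ := (Set.toFinite _).exists_minimal hne
    refine ⟨_, (e a).2, ha.2, fun a' ha' hpa' => ?_⟩
    rcases hc.total ha.1 ha' with h | h
    · exact e.le_iff_le.2 h
    · exact e.le_iff_le.2 (hmin ⟨ha', hpa'⟩ h)
  · exact ⟨Finset.univ, huniv, Finset.mem_univ p, fun a ha hpa => absurd ⟨a, ha, hpa⟩ hne⟩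

include e in
theorem isSupersolvableLattice [Fintype E] (huniv : Finset.univ ∈ guardedFamily S adj) :
    IsSupersolvableLattice L := by
  refine ⟨Finite.of_equiv _ e.symm.toEquiv, ⟨e.symm ⟨_, huniv⟩⟩, lowerElements e,
    isMaxChain_lowerElements e huniv, fun c hc => ?_⟩
  -- `K` consists of the lower sets of the preorder attached to `c`. It contains the initial
  -- segments and `c`, and its joins and meets are unions and intersections.
  let K : Set L := {x | ∀ p ∈ (e x).1, ∀ q ≤ p,
    (∀ a ∈ c, p ∈ (e a).1 → q ∈ (e a).1) → q ∈ (e x).1}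
  have hsup : ∀ x ∈ K, ∀ y ∈ K, x ⊔ y ∈ K := by
    intro x hx y hy p hp q hqp h
    rw [coe_sup, Finset.mem_union] at hp ⊢
    exact hp.imp (fun hp => hx p hp q hqp h) fun hp => hy p hp q hqp h
  have hinf : ∀ x ∈ K, ∀ y ∈ K, (e (x ⊓ y)).1 = (e x).1 ∩ (e y).1 := by
    intro x hx y hy
    refine coe_inf e (mem_of_forall_chain e huniv hc fun p hp q hqp h => ?_)
    rw [Finset.mem_inter] at hp ⊢
    exact ⟨hx p hp.1 q hqp h, hy p hp.2 q hqp h⟩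
  have hK : latticeClosure (lowerElements e ∪ c) ⊆ K := by
    apply latticeClosure_min
    · rintro x (hx | hx)
      · exact fun p hp q hqp _ => hx hqp hp
      · exact fun p hp q _ h => h x hx hp
    · refine ⟨fun x hx y hy => hsup x hx y hy, fun x hx y hy p hp q hqp h => ?_⟩
      rw [hinf x hx y hy, Finset.mem_inter] at hp ⊢
      exact ⟨hx p hp.1 q hqp h, hy p hp.2 q hqp h⟩
  intro x hx y hy z hz
  have hKinf : ∀ x ∈ K, ∀ y ∈ K, x ⊓ y ∈ K := by
    intro x hx y hy p hp q hqp h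
    rw [hinf x hx y hy, Finset.mem_inter] at hp ⊢
    exact ⟨hx p hp.1 q hqp h, hy p hp.2 q hqp h⟩
  apply e.injective
  apply Subtype.ext
  rw [hinf x (hK hx) _ (hsup y (hK hy) z (hK hz)), coe_sup, coe_sup,
    hinf x (hK hx) y (hK hy), hinf x (hK hx) z (hK hz), Finset.inter_union_distrib_left]

theorem exists_insert_mem [Finite E] {A B : Finset E} (hA : A ∈ guardedFamily S adj)
    (hB : B ∈ guardedFamily S adj) (hAB : A ⊂ B) :
    ∃ p ∈ B, p ∉ A ∧ insert p A ∈ guardedFamily S adj := by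
  obtain ⟨p, hpB, hpA⟩ := Finset.exists_of_ssubset hAB
  obtain ⟨x, hx, hmin⟩ :=
    (Set.toFinite {y | y ∈ B ∧ y ∉ A}).exists_minimal ⟨p, hpB, hpA⟩
  refine ⟨x, hx.1, hx.2, isSupersolvableAntimatroid.2 A hA B hB x ⟨hx, fun y hy => ?_⟩⟩
  exact (le_total x y).elim id fun h => hmin hy h

/-- The antimatroid axiom inserts an element between any two strictly nested members, so covers have
size one. -/
theorem covBy_iff [Finite E] {x y : L} :
    x ⋖ y ↔ ∃ p ∉ (e x).1, (e y).1 = insert p (e x).1 := by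
  rw [← apply_covBy_apply_iff e]
  constructor
  · intro h
    have hlt : (e x).1 ⊂ (e y).1 := h.lt
    obtain ⟨p, hp, hpx, hins⟩ := exists_insert_mem (e x).2 (e y).2 hlt
    refine ⟨p, hpx, ?_⟩
    have h1 : e x < ⟨_, hins⟩ := (Finset.ssubset_insert hpx : (e x).1 ⊂ _)
    have h2 : (⟨_, hins⟩ : guardedFamily S adj) ≤ e y :=
      (Finset.insert_subset hp hlt.subset : insert p (e x).1 ⊆ (e y).1)
    exact congrArg Subtype.val ((h.eq_or_eq h1.le h2).resolve_left h1.ne').symm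
  · rintro ⟨p, hp, h⟩
    refine ⟨?_, fun z hxz hzy => ?_⟩
    · change (e x).1 ⊂ (e y).1
      rw [h]
      exact Finset.ssubset_insert hp
    · have hcov : (e x).1 ⋖ (e y).1 := by
        rw [h]
        exact Finset.covBy_insert hp
      exact hcov.2 (c := z.1) hxz hzy

include e in
theorem isJoinDistributiveLattice [Fintype E] (huniv : Finset.univ ∈ guardedFamily S adj) :
    IsJoinDistributiveLattice L := by
  classical
  refine ⟨Finite.of_equiv _ e.symm.toEquiv, ⟨e.symm ⟨_, huniv⟩⟩, fun x j hj => ?_⟩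
  -- `Q` holds the elements that can be added singly to `x`. Any subset of them can be added at
  -- once, so `[x, j]` is the power set of `Q`.
  let Q : Set E := {p | p ∉ (e x).1 ∧ insert p (e x).1 ∈ guardedFamily S adj}
  have hmem : ∀ T : Finset E, (∀ p ∈ T, p ∈ Q) → (e x).1 ∪ T ∈ guardedFamily S adj := by
    intro T hT
    refine mem_of_forall_exists fun p hp => ?_
    rcases Finset.mem_union.1 hp with hp | hp
    · exact ⟨_, (e x).2, hp, Finset.subset_union_left⟩
    · refine ⟨_, (hT p hp).2, Finset.mem_insert_self _ _, ?_⟩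
      exact Finset.insert_subset (Finset.mem_union_right _ hp) Finset.subset_union_left
  have hej : (e j).1 = (e x).1 ∪ Q.toFinset := by
    apply subset_antisymm
    · have h := hmem Q.toFinset (by simp)
      have : j ≤ e.symm ⟨_, h⟩ := by
        apply hj.2
        rintro y (rfl | hy)
        · exact e.le_symm_apply.2 (Finset.subset_union_left (s₁ := (e y).1))
        · obtain ⟨p, hp, hyp⟩ := (covBy_iff e).1 hy
          refine e.le_symm_apply.2 ?_
          change (e y).1 ⊆ (e x).1 ∪ Q.toFinset
          rw [hyp]
          refine Finset.insert_subset (Finset.mem_union_right _ ?_) Finset.subset_union_left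
          rw [Set.mem_toFinset]
          exact ⟨hp, hyp ▸ (e y).2⟩
      exact e.le_symm_apply.1 this
    · refine Finset.union_subset (e.le_iff_le.2 (hj.1 (Or.inl rfl))) fun p hp => ?_
      rw [Set.mem_toFinset] at hp
      have hcov : x ⋖ e.symm ⟨_, hp.2⟩ := (covBy_iff e).2 ⟨p, hp.1, by simp⟩
      exact e.symm_apply_le.1 (hj.1 (Or.inr hcov)) (Finset.mem_insert_self _ _)
  let toSet : Set.Icc x j → Set Q := fun y => {p | p.1 ∈ (e y.1).1}
  have hto : ∀ y z : Set.Icc x j, toSet y ≤ toSet z ↔ y ≤ z := by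
    intro y z
    rw [← Subtype.coe_le_coe, ← e.le_iff_le]
    refine ⟨fun h p hp => ?_, fun h p hp => h hp⟩
    have hpj : p ∈ (e j).1 := (e.le_iff_le.2 y.2.2 : (e y.1).1 ⊆ (e j).1) hp
    rw [hej, Finset.mem_union, Set.mem_toFinset] at hpj
    rcases hpj with hpx | hpQ
    · exact (e.le_iff_le.2 z.2.1 : (e x).1 ⊆ (e z.1).1) hpx
    · exact h (a := ⟨p, hpQ⟩) hp
  have hsurj : Function.Surjective toSet := by
    intro T
    have h := hmem (Subtype.val '' T).toFinset (by simp +contextual)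
    refine ⟨⟨e.symm ⟨_, h⟩, e.le_symm_apply.2 (Finset.subset_union_left (s₁ := (e x).1)),
      e.symm_apply_le.2 ?_⟩, ?_⟩
    · change (e x).1 ∪ (Subtype.val '' T).toFinset ⊆ (e j).1
      rw [hej]
      refine Finset.union_subset_union_right fun p hp => ?_
      rw [Set.mem_toFinset] at hp ⊢
      obtain ⟨p, -, rfl⟩ := hp
      exact p.2
    · ext p
      have := p.2.1
      simp [toSet, this]
  let f : Set.Icc x j ≃o Set Q :=
    RelIso.ofSurjective (OrderEmbedding.ofMapLEIff toSet hto) hsurj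
  obtain ⟨n, ⟨g⟩⟩ := Finite.exists_equiv_fin Q
  exact ⟨n, ⟨f.trans ⟨Equiv.Set.congr g, Set.image_subset_image_iff g.injective⟩⟩⟩

end Lattice

end guardedFamily

/-! ### Words with distinct letters. -/

namespace RootPairing.Base

open RootPairing.weylGroup

variable {ι M N : Type*} [AddCommGroup M] [Module ℝ M] [AddCommGroup N] [Module ℝ N]
  {P : RootPairing ι ℝ M N} (b : P.Base)

theorem ofIdx_smul_of_pairing_eq_zero {i : ι} {m : M} (h : P.toLinearMap m (P.coroot i) = 0) :
    ofIdx P i • m = m := by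
  rw [ofIdx_smul_eq, h, zero_smul, sub_zero]

theorem wordProd_smul_of_forall {l : List b.support} {m : M}
    (h : ∀ i ∈ l, P.toLinearMap m (P.coroot i) = 0) : b.wordProd l • m = m := by
  induction l with
  | nil => simp
  | cons i l ih =>
    rw [wordProd_cons, mul_smul, ih fun j hj => h j (by simp [hj]),
      ofIdx_smul_of_pairing_eq_zero (h i (by simp))]

section RootSystem

variable [P.IsRootSystem]

theorem exists_fundamentalWeight (i : b.support) :
    ∃ m : M, P.toLinearMap m (P.coroot i) = 1 ∧
      ∀ j : b.support, j ≠ i → P.toLinearMap m (P.coroot j) = 0 := by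
  refine ⟨P.toPerfPair.symm (b.toCoweightBasis.coord i), ?_, fun j hj => ?_⟩
  · have := P.toLinearMap.apply_symm_toPerfPair_self (b.toCoweightBasis.coord i)
    rw [this]
    simp
  · have := P.toLinearMap.apply_symm_toPerfPair_self (b.toCoweightBasis.coord i)
    rw [this]
    simp [hj]

/-- The fundamental weight of `i` is fixed by words without `i`, while a word containing `i` exactly
once moves it by a root. -/
theorem mem_of_wordProd_eq {l l' : List b.support} (hl : l.Nodup)
    (h : b.wordProd l = b.wordProd l') {i : b.support} (hi : i ∈ l) : i ∈ l' := by
  by_contra hi'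
  obtain ⟨m, hm, hm'⟩ := b.exists_fundamentalWeight i
  have hfix : ∀ k : List b.support, i ∉ k → b.wordProd k • m = m := fun k hk =>
    b.wordProd_smul_of_forall fun j hj => hm' j (by rintro rfl; exact hk hj)
  obtain ⟨l₁, l₂, rfl⟩ := List.append_of_mem hi
  have hl₁ : i ∉ l₁ := fun h => (List.disjoint_of_nodup_append hl) h (by simp)
  have hl₂ : i ∉ l₂ := (List.nodup_cons.1 hl.of_append_right).1
  have h1 := hfix l' hi'
  rw [← h, wordProd_append, wordProd_cons, mul_smul, mul_smul, hfix l₂ hl₂, ofIdx_smul_eq, hm,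
    smul_sub_smul_root, hfix l₁ hl₁, one_smul, sub_eq_self, ← root_smul] at h1
  exact P.ne_zero _ h1

theorem isReducedWord_of_nodup {l : List b.support} (hl : l.Nodup) :
    b.length (b.wordProd l) = l.length := by
  refine (b.length_le l).antisymm ?_
  refine le_csInf ⟨_, l, rfl, rfl⟩ ?_
  rintro n ⟨l', hl', rfl⟩
  exact (hl.subperm fun i hi => b.mem_of_wordProd_eq hl hl'.symm hi).length_le

theorem IsReducedWord.nodup {w : P.weylGroup} (hw : b.IsCoxeterType w) {l : List b.support}
    (hl : b.IsReducedWord l w) : l.Nodup := by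
  obtain ⟨l₀, hl₀, rfl⟩ := hw
  have hsub := hl₀.subperm fun i hi => b.mem_of_wordProd_eq hl₀ hl.1.symm hi
  have hlen : l.length ≤ l₀.length := (hl.2.trans (b.isReducedWord_of_nodup hl₀)).le
  exact (hsub.perm_of_length_le hlen).nodup_iff.1 hl₀

/-- A letter that does not occur in a word: the corresponding coordinate is fixed by the word. -/
theorem repr_wordProd_smul {l : List b.support} {i : b.support} (hi : i ∉ l) (m : M) :
    b.toWeightBasis.repr (b.wordProd l • m) i = b.toWeightBasis.repr m i := by
  induction l with
  | nil => simp
  | cons k l ih =>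
    rw [List.mem_cons, not_or] at hi
    rw [wordProd_cons, mul_smul, ofIdx_smul_eq, map_sub, map_smul _ _ (P.root k),
      toWeightBasis_repr_root]
    simp [ih hi.2, Ne.symm hi.1]

/-- The first letter `k` is the only one that changes the `k`-coordinate, so `m` must pair to zero
with its coroot; the rest of the word then also fixes `m`. -/
theorem forall_of_wordProd_smul_eq {l : List b.support} (hl : l.Nodup) {m : M}
    (h : b.wordProd l • m = m) : ∀ i ∈ l, P.toLinearMap m (P.coroot i) = 0 := by
  induction l with
  | nil => simp
  | cons k l ih =>
    rw [List.nodup_cons] at hl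
    have h' : b.wordProd l • m = ofIdx P k • m := by
      conv_rhs => rw [← h, wordProd_cons, mul_smul, ← mul_smul, ofIdx_mul_self, one_smul]
    have hk : P.toLinearMap m (P.coroot k) = 0 := by
      have := b.repr_wordProd_smul hl.1 m
      rw [h', ofIdx_smul_eq, map_sub, map_smul, toWeightBasis_repr_root] at this
      simpa using this
    rw [ofIdx_smul_of_pairing_eq_zero hk] at h'
    rintro i hi
    rcases List.mem_cons.1 hi with rfl | hi
    · exact hk
    · exact ih hl.2 h' i hi

/-! ### The Bruhat order below a word without repetitions -/

theorem bruhatLE_delete {l₁ l₂ : List b.support} {i : b.support} (hl : (l₁ ++ i :: l₂).Nodup) :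
    b.BruhatLE (b.wordProd (l₁ ++ l₂)) (b.wordProd (l₁ ++ i :: l₂)) := by
  have hs : (l₁ ++ l₂).Sublist (l₁ ++ i :: l₂) :=
    (List.Sublist.refl l₁).append (List.sublist_cons_self i l₂)
  have hi : b.wordProd l₂ • (b.wordProd l₂)⁻¹ • (i : ι) = (i : ι) := smul_inv_smul _ _
  refine Relation.ReflTransGen.single ⟨⟨(b.wordProd l₂)⁻¹ • (i : ι), ?_⟩, ?_⟩
  · rw [← b.wordProd_delete hi, mul_assoc, ofIdx_mul_self, mul_one]
  · rw [b.isReducedWord_of_nodup hl, b.isReducedWord_of_nodup (hl.sublist hs)]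
    simp

theorem bruhatLE_of_sublist {l l' : List b.support} (h : l'.Sublist l) (hl : l.Nodup) :
    b.BruhatLE (b.wordProd l') (b.wordProd l) := by
  -- Letters kept so far accumulate in a prefix, so that deletions can occur inside the word.
  suffices ∀ pre : List b.support, (pre ++ l).Nodup →
      b.BruhatLE (b.wordProd (pre ++ l')) (b.wordProd (pre ++ l)) from this [] hl
  induction h with
  | slnil => exact fun pre _ => Relation.ReflTransGen.refl
  | @cons l₁ l₂ a _ ih =>
    intro pre hpre
    have hs : (pre ++ l₂).Sublist (pre ++ a :: l₂) :=
      (List.Sublist.refl pre).append (List.sublist_cons_self a l₂)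
    exact (ih hl.of_cons pre (hpre.sublist hs)).trans (b.bruhatLE_delete hpre)
  | @cons_cons l₁ l₂ a _ ih =>
    intro pre hpre
    simpa using ih hl.of_cons (pre ++ [a]) (by simpa using hpre)

variable [Finite ι] [P.IsCrystallographic] [P.IsReduced]

/-! ### Minimal coset representatives among words without repetitions -/

theorem wordProd_mem_minCosetReps_iff {J : Set b.support} {l : List b.support} (hl : l.Nodup) :
    b.wordProd l ∈ b.minCosetReps J ↔ ∀ l₁ i l₂, l = l₁ ++ i :: l₂ → i ∈ J →
      ∃ k ∈ l₂, P.pairing i k ≠ 0 := by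
  rw [mem_minCosetReps_iff]
  constructor
  · rintro h l₁ i l₂ rfl hi
    by_contra! hk
    have hfix : b.wordProd l₂ • (i : ι) = (i : ι) := by
      apply P.root.injective
      rw [root_smul, b.wordProd_smul_of_forall hk]
    have hlt : b.length (b.wordProd (l₁ ++ i :: l₂) * ofIdx P i) <
        b.length (b.wordProd (l₁ ++ i :: l₂)) := by
      rw [b.wordProd_delete hfix, b.isReducedWord_of_nodup hl]
      exact (b.length_le _).trans_lt (by simp)
    exact (b.length_mul_ofIdx_lt_iff (b.isPos_of_mem_support i.2) _).1 hlt (h i hi)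
  · intro h j hj
    by_contra hneg
    obtain ⟨l₁, i, l₂, rfl, h2⟩ :=
      b.exists_split_of_not_isPos (b.isPos_of_mem_support j.2) l hneg
    have hl₂ := List.nodup_cons.1 hl.of_append_right
    have hroot : b.wordProd l₂ • P.root j = P.root i := by rw [← root_smul, h2]
    -- The word `l₂` does not involve `i`, so the `i`-coordinate of the simple root of `j` is
    -- already that of the simple root of `i`.
    have hij : j = i := by
      by_contra hne
      have := b.repr_wordProd_smul hl₂.1 (P.root j)
      rw [hroot] at this
      simp [hne] at this
    subst hij
    obtain ⟨k, hk, hne⟩ := h l₁ j l₂ rfl hj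
    exact hne (b.forall_of_wordProd_smul_eq hl₂.2 hroot k hk)

end RootSystem

end RootPairing.Base

namespace RootPairing.Base

open RootPairing.weylGroup

variable {ι M N : Type*} [AddCommGroup M] [Module ℝ M] [AddCommGroup N] [Module ℝ N]
  {P : RootPairing ι ℝ M N} (b : P.Base)

/-! ### Subwords of a word without repetitions -/

/-- The positions in `A`, in increasing order. -/
def positions (l : List b.support) (A : Finset (Fin l.length)ᵒᵈ) : List (Fin l.length) :=
  (List.finRange l.length).filter fun j => OrderDual.toDual j ∈ A

/-- The subword of `l` at the positions in `A`. -/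
def subword (l : List b.support) (A : Finset (Fin l.length)ᵒᵈ) : List b.support :=
  (b.positions l A).map l.get

theorem mem_positions {l : List b.support} {A : Finset (Fin l.length)ᵒᵈ} {j : Fin l.length} :
    j ∈ b.positions l A ↔ OrderDual.toDual j ∈ A := by
  simp [positions]

theorem pairwise_positions (l : List b.support) (A : Finset (Fin l.length)ᵒᵈ) :
    (b.positions l A).Pairwise (· < ·) :=
  (List.pairwise_lt_finRange _).filter _

theorem map_get_finRange (l : List b.support) : (List.finRange l.length).map l.get = l := by
  simp

theorem subword_sublist_subword {l : List b.support} {A B : Finset (Fin l.length)ᵒᵈ}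
    (h : A ⊆ B) : (b.subword l A).Sublist (b.subword l B) :=
  (List.monotone_filter_right _ fun j hj => by simpa using h (by simpa using hj)).map _

theorem subword_univ (l : List b.support) : b.subword l Finset.univ = l := by
  simp [subword, positions]

theorem subword_sublist (l : List b.support) (A : Finset (Fin l.length)ᵒᵈ) :
    (b.subword l A).Sublist l := by
  simpa [subword_univ] using b.subword_sublist_subword (Finset.subset_univ A)

theorem exists_subword_eq {l l' : List b.support} (hl : l.Nodup) (h : l'.Sublist l) :
    ∃ A, b.subword l A = l' := by
  classical
  -- As `l` has no repetitions, a sublist is determined by its set of letters.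
  have hfilter : l' = l.filter (· ∈ l') := by
    have h1 : l'.Sublist (l.filter (· ∈ l')) := by
      have h2 := h.filter (· ∈ l')
      rwa [List.filter_eq_self.2 fun i hi => by simpa using hi] at h2
    refine h1.eq_of_length_le (List.Subperm.length_le ((hl.filter _).subperm fun i hi => ?_))
    simpa using (List.mem_filter.1 hi).2
  refine ⟨Finset.univ.filter fun j => l.get (OrderDual.ofDual j) ∈ l', ?_⟩
  conv_rhs => rw [hfilter, ← b.map_get_finRange l, List.filter_map]
  simp only [subword, positions]
  congr 1
  refine List.filter_congr fun j _ => ?_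
  simp

theorem subset_of_subword_subset {l : List b.support} (hl : l.Nodup)
    {A B : Finset (Fin l.length)ᵒᵈ} (h : b.subword l A ⊆ b.subword l B) : A ⊆ B := by
  intro p hp
  obtain ⟨p, rfl⟩ := OrderDual.toDual.surjective p
  have hp' : l.get p ∈ b.subword l A :=
    List.mem_map_of_mem (b.mem_positions.2 hp)
  obtain ⟨q, hq, hqp⟩ := List.mem_map.1 (h hp')
  rw [← List.nodup_iff_injective_get.1 hl hqp]
  exact b.mem_positions.1 hq

variable [P.IsRootSystem] [Finite ι] [P.IsCrystallographic] [P.IsReduced]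

theorem subwordProd_bruhatLE_iff {l : List b.support} (hl : l.Nodup)
    {A B : Finset (Fin l.length)ᵒᵈ} :
    b.BruhatLE (b.subwordProd l A) (b.subwordProd l B) ↔ A ⊆ B := by
  refine ⟨fun h => ?_, fun h => b.bruhatLE_of_sublist (b.subword_sublist_subword h)
    (hl.sublist (b.subword_sublist l B))⟩
  obtain ⟨l', hl', h⟩ := b.exists_sublist_of_bruhatLE (l := b.subword l B) h
  exact b.subset_of_subword_subset hl fun i hi => hl'.subset
    (b.mem_of_wordProd_eq (hl.sublist (b.subword_sublist l A)) h.symm hi)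

/-- Later letters of the word are smaller positions in the reversed order, so the criterion for
`W^P` becomes the guard condition. -/
theorem feasibleSets_eq (J : Set b.support) {l : List b.support} (hl : l.Nodup) :
    b.feasibleSets J l = guardedFamily {p | l.get (OrderDual.ofDual p) ∈ J}
      fun p q => P.pairing (l.get (OrderDual.ofDual p)) (l.get (OrderDual.ofDual q)) ≠ 0 := by
  ext A
  have hiff := b.wordProd_mem_minCosetReps_iff (J := J) (hl.sublist (b.subword_sublist l A))
  refine hiff.trans ⟨fun h p hp hpJ => ?_, fun h l₁ i l₂ hl' hi => ?_⟩
  · obtain ⟨p, rfl⟩ := OrderDual.toDual.surjective p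
    obtain ⟨F₁, F₂, hF⟩ := List.append_of_mem (b.mem_positions.2 hp)
    obtain ⟨k, hk, hne⟩ := h (F₁.map l.get) _ (F₂.map l.get) (by simp [subword, hF]) hpJ
    obtain ⟨q, hq, rfl⟩ := List.mem_map.1 hk
    have hpw := b.pairwise_positions l A
    rw [hF, List.pairwise_append, List.pairwise_cons] at hpw
    exact ⟨OrderDual.toDual q, b.mem_positions.1 (by simp [hF, hq]), hpw.2.1.1 q hq, hne⟩
  · obtain ⟨F₁, F', hF, rfl, hF'⟩ := List.map_eq_append_iff.1 hl'
    obtain ⟨p, F₂, rfl, rfl, rfl⟩ := List.map_eq_cons_iff.1 hF'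
    have hpA : OrderDual.toDual p ∈ A := b.mem_positions.1 (by simp [hF])
    obtain ⟨q, hq, hlt, hne⟩ := h _ hpA hi
    obtain ⟨q, rfl⟩ := OrderDual.toDual.surjective q
    refine ⟨_, List.mem_map_of_mem ?_, hne⟩
    have hlt' : p < q := hlt
    have hqF := b.mem_positions.2 hq
    have hpw := b.pairwise_positions l A
    rw [hF, List.pairwise_append] at hpw
    rw [hF, List.mem_append, List.mem_cons] at hqF
    rcases hqF with hq | hq | hq
    · exact absurd (hpw.2.2 _ hq p (by simp)) hlt'.not_gt
    · exact absurd hq hlt'.ne'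
    · exact hq

theorem exists_orderIso_projInterval {J : Set b.support} {l : List b.support} (hl : l.Nodup) :
    ∃ φ : b.feasibleSets J l ≃o b.ProjInterval J (b.wordProd l),
      ∀ A : b.feasibleSets J l, (φ A).1 = b.subwordProd l A.1 := by
  let f : b.feasibleSets J l → b.ProjInterval J (b.wordProd l) := fun A =>
    ⟨b.subwordProd l A.1, A.2,
      b.bruhatLE_of_sublist (List.nil_sublist (b.subword l A.1))
        (hl.sublist (b.subword_sublist l A.1)),
      b.bruhatLE_of_sublist (b.subword_sublist l A.1) hl⟩
  have hf : ∀ A B, f A ≤ f B ↔ A ≤ B := fun A B => b.subwordProd_bruhatLE_iff hl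
  have hsurj : Function.Surjective f := by
    rintro ⟨v, hv, -, hvw⟩
    obtain ⟨l', hl', rfl⟩ := b.exists_sublist_of_bruhatLE hvw
    obtain ⟨A, rfl⟩ := b.exists_subword_eq hl hl'
    exact ⟨⟨A, hv⟩, rfl⟩
  exact ⟨RelIso.ofSurjective (OrderEmbedding.ofMapLEIff f hf) hsurj, fun _ => rfl⟩

end RootPairing.Base

theorem mainTheorem5 {ι M N : Type*} [Finite ι] [AddCommGroup M] [Module ℝ M]
    [AddCommGroup N] [Module ℝ N] (P : RootPairing ι ℝ M N) [P.IsRootSystem]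
    [P.IsCrystallographic] [P.IsReduced] (b : P.Base) (J : Set b.support)
    (w : P.weylGroup) (hw : w ∈ b.minCosetReps J) (hc : b.IsCoxeterType w) :
    (∃ l : List b.support, b.IsReducedWord l w) ∧
    (∀ l : List b.support, b.IsReducedWord l w →
      IsSupersolvableAntimatroid (b.feasibleSets J l) ∧
      ∃ φ : b.feasibleSets J l ≃o b.ProjInterval J w,
        ∀ A : b.feasibleSets J l, (φ A).1 = b.subwordProd l A.1) ∧
    ∃ lat : Lattice (b.ProjInterval J w),
      lat.toPartialOrder = (inferInstance : PartialOrder (b.ProjInterval J w)) ∧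
      IsSupersolvableLattice (b.ProjInterval J w) ∧
      IsJoinDistributiveLattice (b.ProjInterval J w) := by
  refine ⟨b.exists_isReducedWord w, fun l hl => ?_, ?_⟩
  · have hnodup := RootPairing.Base.IsReducedWord.nodup b hc hl
    obtain ⟨rfl, -⟩ := hl
    refine ⟨?_, b.exists_orderIso_projInterval hnodup⟩
    rw [b.feasibleSets_eq J hnodup]
    exact guardedFamily.isSupersolvableAntimatroid
  · obtain ⟨l, hl, rfl⟩ := hc
    obtain ⟨φ, -⟩ := b.exists_orderIso_projInterval (J := J) hl
    -- The full subword is `w` itself, which lies in `W^P`.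
    have huniv : Finset.univ ∈ b.feasibleSets J l := by
      change b.wordProd (b.subword l Finset.univ) ∈ b.minCosetReps J
      rwa [b.subword_univ]
    rw [b.feasibleSets_eq J hl] at φ huniv
    obtain ⟨lat, hlat⟩ := guardedFamily.exists_lattice φ.symm
    let ψ := φ.symm
    clear_value ψ
    rw [← hlat] at ψ
    exact ⟨lat, hlat, guardedFamily.isSupersolvableLattice ψ huniv,
      guardedFamily.isJoinDistributiveLattice ψ huniv⟩
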